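/- Let $\mathcal{H}$ be an infinite-dimensional complex Hilbert space, $\mathcal{B}(\mathcal{H})$ the algebra of bounded linear operators on $\mathcal{H}$ with the operator norm, $\mathcal{K}(\mathcal{H})$ the ideal of compact operators, and $\mathcal{L}^1(\mathcal{H})$ the ideal of trace class operators with the trace norm $\|a\|_1=\mathrm{Tr}\,|a|$, where $|a|=(a^*a)^{1/2}$. Let $\mathcal{V}$ be a finite-dimensional subspace of $\mathcal{K}(\mathcal{H})$, and let $N_{\mathcal{V}}$ be the set of all $a\in\mathcal{B}(\mathcal{H})$ such that, for every $y\in\mathcal{V}$, $ay$ is of trace class and $\mathrm{Tr}(ay)=0$. Let $x\in\mathcal{B}(\mathcal{H})\setminus\mathcal{K}(\mathcal{H})$, and suppose that either (a) $\|x\xi\|=\|x\|$ for every unit vector $\xi\in\mathcal{H}$, or (b) $\|x\xi\|\neq\|x\|$ for every unit vector $\xi\in\mathcal{H}$. Then $$\mathrm{dist}(x,\mathcal{K}(\mathcal{H}))=\mathrm{dist}(x,\mathcal{V})=\sup\{|\mathrm{Tr}(ax)|:\ a\in\mathcal{L}^1(\mathcal{H})\cap N_{\mathcal{V}},\ \|a\|_1=1\}=\|x\|,$$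 where $\mathrm{dist}(x,S)=\inf_{s\in S}\|x-s\|$. -/

import Mathlib

open scoped InnerProductSpace

noncomputable section

namespace OperatorDistance

variable {H : Type*} [NormedAddCommGroup H] [InnerProductSpace ℂ H] [CompleteSpace H]
variable {ι : Type*}

/-- The ideal `K(H)` of compact operators, as a subspace of `B(H)`. -/
abbrev compacts (H : Type*) [NormedAddCommGroup H] [InnerProductSpace ℂ H] :
    Submodule ℂ (H →L[ℂ] H) :=
  compactOperator (RingHom.id ℂ) H H

/-- `a` is of trace class: `∑ᵢ ⟨|a| eᵢ, eᵢ⟩ < ∞`, where `|a| = (a* a)^(1/2)` and `e` is an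
orthonormal (Hilbert) basis. The terms are nonnegative reals. -/
def IsTraceClass (e : HilbertBasis ι ℂ H) (a : H →L[ℂ] H) : Prop :=
  Summable fun i => (⟪e i, CFC.abs a (e i)⟫_ℂ).re

/-- The trace norm `‖a‖₁ = Tr |a|` of a trace class operator. -/
def traceNorm (e : HilbertBasis ι ℂ H) (a : H →L[ℂ] H) : ℝ :=
  ∑' i, (⟪e i, CFC.abs a (e i)⟫_ℂ).re

/-- The trace of a trace class operator (the inner product is linear in the second variable, so
the `i`-th term is the `i`-th diagonal entry of `a` in the basis `e`). -/
def trace (e : HilbertBasis ι ℂ H) (a : H →L[ℂ] H) : ℂ :=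
  ∑' i, ⟪e i, a (e i)⟫_ℂ

/-- The set `N_V` of all bounded operators `a` such that, for every `y ∈ V`, the trace of `a y`
exists and is zero. -/
def traceAnnihilator (e : HilbertBasis ι ℂ H) (V : Submodule ℂ (H →L[ℂ] H)) :
    Set (H →L[ℂ] H) :=
  {a | ∀ y ∈ V, IsTraceClass e (a * y) ∧ trace e (a * y) = 0}

/-- `x` attains its norm at every unit vector. -/
def AttainsNormEverywhere (x : H →L[ℂ] H) : Prop :=
  ∀ ξ : H, ‖ξ‖ = 1 → ‖x ξ‖ = ‖x‖

/-- `x` attains its norm at no unit vector. -/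
def AttainsNormNowhere (x : H →L[ℂ] H) : Prop :=
  ∀ ξ : H, ‖ξ‖ = 1 → ‖x ξ‖ ≠ ‖x‖

end OperatorDistance

end

open scoped InnerProductSpace

noncomputable section

namespace OperatorDistance

set_option linter.unusedSectionVars false

open Filter Topology
open InnerProductSpace (rankOne)

variable {H : Type*} [NormedAddCommGroup H] [InnerProductSpace ℂ H] [CompleteSpace H]
variable {ι : Type*}

/-! ### Weakly null sequences -/

/-! Everything rests on unit vectors `v n` that converge weakly to 0 while `‖x (v n)‖ → ‖x‖`. In
case (a) any orthonormal sequence will do. In case (b) any maximizing sequence will do: `D = ‖x‖² -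
x* x` is self-adjoint and injective, so its range is dense, and `D (v n) → 0` forces weak nullity.

Compact operators send `v n` to 0 in norm, so subtracting one cannot lower the norm of `x`; as 0
lies in both subspaces, both distances are `‖x‖` (`norm_le_norm_sub_compact`).

The supremum is at most `‖x‖` by `norm_trace_mul_le`. Conversely, the rank one operators built from
`v n` and `x (v n) / ‖x (v n)‖` pair with `x` to `‖x (v n)‖` and with `V` almost to 0. Finite rank
operators dual to a basis of `V` (`pi_traceMul_surjective`) remove the defect with coefficients
tending to 0, so trace norms stay asymptotically at most 1. -/

/-- Orthonormal sequences are weakly null. -/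
theorem _root_.Orthonormal.tendsto_inner_zero {v : ℕ → H} (hv : Orthonormal ℂ v) (ζ : H) :
    Tendsto (fun n => ⟪v n, ζ⟫_ℂ) atTop (𝓝 0) := by
  have h := (hv.inner_products_summable (x := ζ)).tendsto_atTop_zero
  rw [tendsto_zero_iff_norm_tendsto_zero]
  have h2 := h.sqrt
  simpa using h2

/-- Compact operators map bounded weakly null sequences to norm null sequences. -/
theorem tendsto_compact_apply_zero {k : H →L[ℂ] H} (hk : k ∈ compacts H) {v : ℕ → H}
    (hv : ∀ n, ‖v n‖ = 1) (hw : ∀ ζ, Tendsto (fun n => ⟪v n, ζ⟫_ℂ) atTop (𝓝 0)) :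
    Tendsto (fun n => k (v n)) atTop (𝓝 0) := by
  have hk' : IsCompactOperator k := hk
  obtain ⟨K, hK, hsub⟩ := IsCompactOperator.image_closedBall_subset_compact
    (f := (k : H →ₗ[ℂ] H)) hk' 1
  -- In a compact set it suffices that 0 is the only cluster point `z`; weak nullity against `k* z`
  -- gives `⟪z, z⟫ = 0`.
  refine hK.tendsto_nhds_of_unique_mapClusterPt
    (Eventually.of_forall fun n => hsub ⟨v n, by simp [hv], rfl⟩) ?_
  intro z _ hz
  have h1 : MapClusterPt ⟪z, z⟫_ℂ atTop (fun n => ⟪k (v n), z⟫_ℂ) :=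
    hz.continuousAt_comp (f := fun y => ⟪y, z⟫_ℂ) (by fun_prop)
  have h2 : Tendsto (fun n => ⟪k (v n), z⟫_ℂ) atTop (𝓝 0) := by
    simpa only [← ContinuousLinearMap.adjoint_inner_right] using
      hw (ContinuousLinearMap.adjoint k z)
  have h3 : ⟪z, z⟫_ℂ = 0 := by
    have : ClusterPt ⟪z, z⟫_ℂ (𝓝 (0 : ℂ)) := h1.clusterPt.mono h2
    exact eq_of_nhds_neBot this
  exact inner_self_eq_zero.mp h3

/-- Expand the square and use `‖x* x ξ‖ ≤ ‖x‖ ‖x ξ‖`. Near-maximizers of `x` are thus approximate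
eigenvectors of `x* x` at `‖x‖²`. -/
theorem norm_normSq_smul_sub_sq_le (x : H →L[ℂ] H) {ξ : H} (hξ : ‖ξ‖ = 1) :
    ‖((‖x‖ ^ 2 : ℝ) : ℂ) • ξ - ContinuousLinearMap.adjoint x (x ξ)‖ ^ 2 ≤
      ‖x‖ ^ 2 * (‖x‖ ^ 2 - ‖x ξ‖ ^ 2) := by
  rw [@norm_sub_sq ℂ, norm_smul, inner_smul_left, ContinuousLinearMap.adjoint_inner_right,
    inner_self_eq_norm_sq_to_K, hξ]
  have h1 : ‖ContinuousLinearMap.adjoint x (x ξ)‖ ≤ ‖x‖ * ‖x ξ‖ := by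
    simpa using (ContinuousLinearMap.adjoint x).le_opNorm (x ξ)
  have h2 : ‖ContinuousLinearMap.adjoint x (x ξ)‖ ^ 2 ≤ (‖x‖ * ‖x ξ‖) ^ 2 := by gcongr
  have h3 : RCLike.re ((starRingEnd ℂ) ((‖x‖ ^ 2 : ℝ) : ℂ) * ((‖x ξ‖ : ℝ) : ℂ) ^ 2) =
      ‖x‖ ^ 2 * ‖x ξ‖ ^ 2 := by
    rw [Complex.conj_ofReal, ← Complex.ofReal_pow, ← Complex.ofReal_mul]
    exact Complex.ofReal_re _
  have h4 : ‖((‖x‖ ^ 2 : ℝ) : ℂ)‖ = ‖x‖ ^ 2 := by simp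
  erw [h3]
  rw [h4]
  nlinarith

theorem exists_maximizing_seq [Nontrivial H] (x : H →L[ℂ] H) :
    ∃ v : ℕ → H, (∀ n, ‖v n‖ = 1) ∧ Tendsto (fun n => ‖x (v n)‖) atTop (𝓝 ‖x‖) := by
  have key : ∀ n : ℕ, ∃ v : H, ‖v‖ = 1 ∧ ‖x‖ - 1 / ((n : ℝ) + 1) ≤ ‖x v‖ := by
    intro n
    by_contra! hcon
    have hpos : (0 : ℝ) < 1 / ((n : ℝ) + 1) := by positivity
    obtain ⟨v₀, hv₀⟩ := exists_norm_eq H (zero_le_one (α := ℝ))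
    have hnn : 0 ≤ ‖x‖ - 1 / ((n : ℝ) + 1) := (norm_nonneg _).trans (hcon v₀ hv₀).le
    have : ‖x‖ ≤ ‖x‖ - 1 / ((n : ℝ) + 1) := by
      refine x.opNorm_le_of_unit_norm hnn fun z hz => (hcon z hz).le
    linarith
  choose v hv hxv using key
  refine ⟨v, hv, tendsto_of_tendsto_of_tendsto_of_le_of_le ?_ tendsto_const_nhds hxv ?_⟩
  · simpa using tendsto_const_nhds.sub (tendsto_one_div_add_atTop_nhds_zero_nat (𝕜 := ℝ))
  · intro n
    simpa [hv n] using x.le_opNorm (v n)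

/-- If `x` attains its norm at no unit vector, every maximizing sequence is weakly null. -/
theorem AttainsNormNowhere.tendsto_inner_zero {x : H →L[ℂ] H} (hx : AttainsNormNowhere x)
    {v : ℕ → H} (hv : ∀ n, ‖v n‖ = 1) (hxv : Tendsto (fun n => ‖x (v n)‖) atTop (𝓝 ‖x‖)) (ζ : H) :
    Tendsto (fun n => ⟪v n, ζ⟫_ℂ) atTop (𝓝 0) := by
  set D : H →L[ℂ] H := ((‖x‖ ^ 2 : ℝ) : ℂ) • ContinuousLinearMap.id ℂ H -
    ContinuousLinearMap.adjoint x ∘L x with hD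
  have hDapp : ∀ ξ, D ξ = ((‖x‖ ^ 2 : ℝ) : ℂ) • ξ - ContinuousLinearMap.adjoint x (x ξ) := by
    intro ξ; simp [hD]
  have hDsym : ∀ ξ η, ⟪D ξ, η⟫_ℂ = ⟪ξ, D η⟫_ℂ := by
    intro ξ η
    rw [hDapp, hDapp, inner_sub_left, inner_sub_right, inner_smul_left, inner_smul_right,
      ContinuousLinearMap.adjoint_inner_left, ContinuousLinearMap.adjoint_inner_right,
      Complex.conj_ofReal]
  have hDv : Tendsto (fun n => D (v n)) atTop (𝓝 0) := by
    rw [tendsto_zero_iff_norm_tendsto_zero]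
    have h1 : Tendsto (fun n => √(‖x‖ ^ 2 * (‖x‖ ^ 2 - ‖x (v n)‖ ^ 2))) atTop (𝓝 0) := by
      have := ((tendsto_const_nhds (x := ‖x‖ ^ 2)).mul
        ((tendsto_const_nhds (x := ‖x‖ ^ 2)).sub (hxv.pow 2))).sqrt
      simpa using this
    refine squeeze_zero (fun _ => norm_nonneg _) (fun n => ?_) h1
    apply Real.le_sqrt_of_sq_le
    rw [hDapp]
    exact norm_normSq_smul_sub_sq_le x (hv n)
  -- A nonzero kernel vector, once normalized, would attain the norm of `x`.
  have hker : ∀ ξ, D ξ = 0 → ξ = 0 := by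
    intro ξ hξ
    by_contra hne
    have hpos : 0 < ‖ξ‖ := norm_pos_iff.mpr hne
    have h1 : ⟪ξ, D ξ⟫_ℂ = ((‖x‖ ^ 2 * ‖ξ‖ ^ 2 - ‖x ξ‖ ^ 2 : ℝ) : ℂ) := by
      rw [hDapp, inner_sub_right, inner_smul_right, ContinuousLinearMap.adjoint_inner_right,
        inner_self_eq_norm_sq_to_K, inner_self_eq_norm_sq_to_K]
      push_cast
      rfl
    rw [hξ, inner_zero_right] at h1
    have h2 : ‖x‖ ^ 2 * ‖ξ‖ ^ 2 - ‖x ξ‖ ^ 2 = 0 := by exact_mod_cast h1.symm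
    have h3 : ‖x ξ‖ = ‖x‖ * ‖ξ‖ := by
      rw [← sq_eq_sq₀ (norm_nonneg _) (by positivity)]
      linarith [mul_pow ‖x‖ ‖ξ‖ 2]
    refine hx (((‖ξ‖⁻¹ : ℝ) : ℂ) • ξ) ?_ ?_
    · simp [norm_smul, hpos.ne']
    · rw [map_smul, norm_smul, h3]
      simp only [Complex.norm_real, norm_inv, norm_norm]
      field_simp
  have hdense : Dense (D.range : Set H) := by
    rw [Submodule.dense_iff_topologicalClosure_eq_top,
      Submodule.topologicalClosure_eq_top_iff, Submodule.eq_bot_iff]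
    intro η hη
    apply hker
    rw [← inner_self_eq_zero (𝕜 := ℂ), hDsym]
    exact (Submodule.mem_orthogonal' _ _).mp hη _ ⟨D η, rfl⟩
  rw [Metric.tendsto_atTop]
  intro ε hε
  obtain ⟨_, hη, η, rfl⟩ := Metric.dense_iff.mp hdense ζ (ε / 2) (by positivity)
  have h1 : Tendsto (fun n => ⟪v n, D η⟫_ℂ) atTop (𝓝 0) := by
    simp only [← hDsym]
    simpa using hDv.inner (tendsto_const_nhds (x := η)) (𝕜 := ℂ)
  obtain ⟨N, hN⟩ := Metric.tendsto_atTop.mp h1 (ε / 2) (by positivity)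
  refine ⟨N, fun n hn => ?_⟩
  have h2 := hN n hn
  rw [dist_zero_right] at h2 ⊢
  have h3 : ‖⟪v n, ζ - D η⟫_ℂ‖ < ε / 2 := by
    calc _ ≤ ‖v n‖ * ‖ζ - D η‖ := norm_inner_le_norm _ _
      _ < ε / 2 := by
        rw [hv, one_mul, ← dist_eq_norm, dist_comm]
        exact hη
  calc ‖⟪v n, ζ⟫_ℂ‖ = ‖⟪v n, ζ - D η⟫_ℂ + ⟪v n, D η⟫_ℂ‖ := by rw [← inner_add_right]; simp
    _ ≤ _ := norm_add_le _ _
    _ < ε := by linarith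

theorem _root_.HilbertBasis.infinite_of_not_finiteDimensional (hH : ¬ FiniteDimensional ℂ H)
    (e : HilbertBasis ι ℂ H) : Infinite ι := by
  by_contra h
  rw [not_infinite_iff_finite] at h
  have := Fintype.ofFinite ι
  exact hH (e.toOrthonormalBasis.toBasis.finiteDimensional_of_finite)

/-- Under either norm attainment hypothesis there is a weakly null maximizing sequence of unit
vectors. -/
theorem exists_weaklyNull_maximizing_seq (hH : ¬ FiniteDimensional ℂ H) (e : HilbertBasis ι ℂ H)
    {x : H →L[ℂ] H} (hx : AttainsNormEverywhere x ∨ AttainsNormNowhere x) :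
    ∃ v : ℕ → H, (∀ n, ‖v n‖ = 1) ∧ Tendsto (fun n => ‖x (v n)‖) atTop (𝓝 ‖x‖) ∧
      ∀ ζ, Tendsto (fun n => ⟪v n, ζ⟫_ℂ) atTop (𝓝 0) := by
  rcases hx with hx | hx
  · have := e.infinite_of_not_finiteDimensional hH
    have ho : Orthonormal ℂ (e ∘ Infinite.natEmbedding ι) :=
      e.orthonormal.comp _ (Infinite.natEmbedding ι).injective
    refine ⟨_, ho.1, ?_, ho.tendsto_inner_zero⟩
    simp only [hx _ (ho.1 _)]
    exact tendsto_const_nhds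
  · have : Nontrivial H := by
      by_contra h
      rw [not_nontrivial_iff_subsingleton] at h
      exact hH inferInstance
    obtain ⟨v, hv, hxv⟩ := exists_maximizing_seq x
    exact ⟨v, hv, hxv, hx.tendsto_inner_zero hv hxv⟩

/-- An operator with a weakly null maximizing sequence has distance `‖x‖` to the compacts. -/
theorem norm_le_norm_sub_compact {x k : H →L[ℂ] H} (hk : k ∈ compacts H) {v : ℕ → H}
    (hv : ∀ n, ‖v n‖ = 1) (hxv : Tendsto (fun n => ‖x (v n)‖) atTop (𝓝 ‖x‖))
    (hw : ∀ ζ, Tendsto (fun n => ⟪v n, ζ⟫_ℂ) atTop (𝓝 0)) : ‖x‖ ≤ ‖x - k‖ := by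
  have h1 : Tendsto (fun n => ‖x (v n)‖ - ‖k (v n)‖) atTop (𝓝 (‖x‖ - 0)) :=
    hxv.sub (by simpa using (tendsto_compact_apply_zero hk hv hw).norm)
  rw [sub_zero] at h1
  refine le_of_tendsto' h1 fun n => (norm_sub_norm_le _ _).trans ?_
  simpa [hv n] using (x - k).le_opNorm (v n)

/-! ### Trace class operators -/

/-- An operator dominated by `b` pointwise factors through `b` by a contraction. -/
theorem exists_contraction_mul_eq {a b : H →L[ℂ] H} (h : ∀ v, ‖a v‖ ≤ ‖b v‖) :
    ∃ u : H →L[ℂ] H, ‖u‖ ≤ 1 ∧ u * b = a := by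
  -- `u` extends `b v ↦ a v` continuously to the closed range of `b` and vanishes on its orthogonal
  -- complement.
  set K : Submodule ℂ H := b.range.topologicalClosure
  have hK : IsClosed (K : Set H) := b.range.isClosed_topologicalClosure
  have : CompleteSpace K := hK.completeSpace_coe
  let g : H →ₗ[ℂ] K := (b : H →ₗ[ℂ] H).codRestrict K
    fun v => b.range.le_topologicalClosure ⟨v, rfl⟩
  have hg : DenseRange g := by
    intro y
    rw [closure_subtype]
    have : (Subtype.val '' Set.range g : Set H) = b.range := by
      ext z; simp [g]
    rw [this]
    exact y.2
  have hn : ∀ v, ‖(a : H →ₗ[ℂ] H) v‖ ≤ 1 * ‖g v‖ := fun v => by simpa [g] using h v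
  refine ⟨(a : H →ₗ[ℂ] H).extendOfNorm g ∘L K.orthogonalProjectionOnto, ?_, ?_⟩
  · refine (ContinuousLinearMap.opNorm_comp_le _ _).trans ?_
    exact mul_le_one₀ (LinearMap.opNorm_extendOfNorm_le hg zero_le_one hn) (norm_nonneg _)
      K.orthogonalProjectionOnto_norm_le
  · ext v
    have h1 : K.orthogonalProjectionOnto (b v) = g v :=
      K.orthogonalProjectionOnto_mem_subspace_eq_self (g v)
    change (a : H →ₗ[ℂ] H).extendOfNorm g (K.orthogonalProjectionOnto (b v)) = a v
    rw [h1, LinearMap.extendOfNorm_eq hg ⟨1, hn⟩]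
    rfl

theorem norm_abs_apply (a : H →L[ℂ] H) (v : H) : ‖CFC.abs a v‖ = ‖a v‖ := by
  have hsa : ContinuousLinearMap.adjoint (CFC.abs a) = CFC.abs a :=
    (CFC.abs_nonneg a).isSelfAdjoint
  have h : ⟪CFC.abs a v, CFC.abs a v⟫_ℂ = ⟪a v, a v⟫_ℂ := by
    conv_lhs => rw [← ContinuousLinearMap.adjoint_inner_right, hsa]
    rw [← ContinuousLinearMap.adjoint_inner_right]
    exact congrArg (fun T : H →L[ℂ] H => ⟪v, T v⟫_ℂ) (CFC.abs_mul_abs a)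
  rw [inner_self_eq_norm_sq_to_K, inner_self_eq_norm_sq_to_K] at h
  rw [← sq_eq_sq₀ (norm_nonneg _) (norm_nonneg _)]
  exact_mod_cast h

theorem re_inner_abs_nonneg (a : H →L[ℂ] H) (v : H) : 0 ≤ (⟪v, CFC.abs a v⟫_ℂ).re :=
  ((ContinuousLinearMap.nonneg_iff_isPositive _).mp (CFC.abs_nonneg a)).re_inner_nonneg_right v

/-- `C` bounds all partial diagonal sums of `w a` for contractions `w`; this dominates the trace
norm of `a`. -/
def TraceBound (e : HilbertBasis ι ℂ H) (a : H →L[ℂ] H) (C : ℝ) : Prop :=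
  ∀ w : H →L[ℂ] H, ‖w‖ ≤ 1 → ∀ F : Finset ι, ‖∑ i ∈ F, ⟪e i, w (a (e i))⟫_ℂ‖ ≤ C

namespace TraceBound

variable {e : HilbertBasis ι ℂ H} {a b : H →L[ℂ] H} {C D : ℝ}

theorem add (ha : TraceBound e a C) (hb : TraceBound e b D) : TraceBound e (a + b) (C + D) := by
  intro w hw F
  simp only [_root_.add_apply, map_add, inner_add_right, Finset.sum_add_distrib]
  exact norm_add_le_of_le (ha w hw F) (hb w hw F)

theorem smul (ha : TraceBound e a C) (c : ℂ) : TraceBound e (c • a) (‖c‖ * C) := by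
  intro w hw F
  simp only [_root_.smul_apply, map_smul, inner_smul_right, ← Finset.mul_sum, norm_mul]
  exact mul_le_mul_of_nonneg_left (ha w hw F) (norm_nonneg _)

theorem zero : TraceBound e (0 : H →L[ℂ] H) 0 := by
  intro w _ F
  simp

theorem sum {κ : Type*} (s : Finset κ) {f : κ → H →L[ℂ] H} {B : κ → ℝ}
    (h : ∀ k ∈ s, TraceBound e (f k) (B k)) : TraceBound e (∑ k ∈ s, f k) (∑ k ∈ s, B k) := by
  induction s using Finset.cons_induction with
  | empty => simpa using zero
  | cons k s hk ih =>
    rw [Finset.sum_cons, Finset.sum_cons]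
    exact (h k (Finset.mem_cons_self _ _)).add
      (ih fun j hj => h j (Finset.mem_cons_of_mem hj))

/-- Cauchy-Schwarz, then Bessel's inequality for `q` and for `w p`. -/
theorem rankOne (p q : H) : TraceBound e (rankOne ℂ p q) (‖p‖ * ‖q‖) := by
  intro w hw F
  have hb : ∀ z : H, √(∑ i ∈ F, ‖⟪e i, z⟫_ℂ‖ ^ 2) ≤ ‖z‖ := fun z =>
    Real.sqrt_le_iff.mpr ⟨norm_nonneg _, e.orthonormal.sum_inner_products_le z⟩
  calc ‖∑ i ∈ F, ⟪e i, w (InnerProductSpace.rankOne ℂ p q (e i))⟫_ℂ‖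
      ≤ ∑ i ∈ F, ‖⟪e i, q⟫_ℂ‖ * ‖⟪e i, w p⟫_ℂ‖ := by
        refine norm_sum_le_of_le _ fun i _ => ?_
        rw [InnerProductSpace.rankOne_apply, map_smul, inner_smul_right, norm_mul,
          norm_inner_symm]
    _ ≤ √(∑ i ∈ F, ‖⟪e i, q⟫_ℂ‖ ^ 2) * √(∑ i ∈ F, ‖⟪e i, w p⟫_ℂ‖ ^ 2) :=
        Real.sum_mul_le_sqrt_mul_sqrt _ _ _
    _ ≤ ‖q‖ * ‖w p‖ := mul_le_mul (hb _) (hb _) (Real.sqrt_nonneg _) (norm_nonneg _)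
    _ ≤ ‖q‖ * ‖p‖ := by
        gcongr
        simpa using w.le_of_opNorm_le hw p
    _ = ‖p‖ * ‖q‖ := mul_comm _ _

/-- `|a| = w a` for some contraction `w`. This is why `TraceBound` ranges over contractions: unlike
`|a|`, the sums it bounds are additive in `a`, so no triangle inequality for the trace norm is
needed. -/
theorem sum_re_abs_le (ha : TraceBound e a C) (F : Finset ι) :
    ∑ i ∈ F, (⟪e i, CFC.abs a (e i)⟫_ℂ).re ≤ C := by
  obtain ⟨w, hw, hwa⟩ := exists_contraction_mul_eq (a := CFC.abs a) (b := a)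
    fun v => (norm_abs_apply a v).le
  rw [← Complex.re_sum, ← hwa]
  exact (Complex.re_le_norm _).trans (ha w hw F)

theorem isTraceClass (ha : TraceBound e a C) : IsTraceClass e a :=
  summable_of_sum_le (fun _ => re_inner_abs_nonneg _ _) ha.sum_re_abs_le

theorem traceNorm_le (ha : TraceBound e a C) : traceNorm e a ≤ C :=
  Real.tsum_le_of_sum_le (fun _ => re_inner_abs_nonneg _ _) ha.sum_re_abs_le

end TraceBound

/-- Hilbert-Schmidt estimate for `s x` with `s` self-adjoint. -/
theorem sum_norm_sq_mul_le (e : HilbertBasis ι ℂ H) {s : H →L[ℂ] H} (hs : IsSelfAdjoint s)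
    (hsum : Summable fun i => ‖s (e i)‖ ^ 2) (x : H →L[ℂ] H) (F : Finset ι) :
    ∑ i ∈ F, ‖s (x (e i))‖ ^ 2 ≤ ‖x‖ ^ 2 * ∑' i, ‖s (e i)‖ ^ 2 := by
  have hs' : ContinuousLinearMap.adjoint s = s := hs
  have h1 : ∀ z : H, HasSum (fun j => ‖⟪e j, z⟫_ℂ‖ ^ 2) (‖z‖ ^ 2) := by
    intro z
    have h := e.hasSum_inner_mul_inner z z
    rw [inner_self_eq_norm_sq_to_K] at h
    have h2 : ∀ j, ⟪z, e j⟫_ℂ * ⟪e j, z⟫_ℂ = ((‖⟪e j, z⟫_ℂ‖ ^ 2 : ℝ) : ℂ) := fun j => by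
      rw [← inner_conj_symm, Complex.conj_mul']
      push_cast
      rfl
    simp only [h2] at h
    exact Complex.hasSum_ofReal.mp (by rw [Complex.ofReal_pow]; exact h)
  -- Parseval for each `s (x (e i))`, then exchange the sums and apply Bessel to `x* s (e j)`.
  refine hasSum_le (fun j => ?_) (hasSum_sum fun i _ => h1 (s (x (e i))))
    (hsum.hasSum.mul_left (‖x‖ ^ 2))
  calc ∑ i ∈ F, ‖⟪e j, s (x (e i))⟫_ℂ‖ ^ 2
      = ∑ i ∈ F, ‖⟪e i, ContinuousLinearMap.adjoint x (s (e j))⟫_ℂ‖ ^ 2 := by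
        refine Finset.sum_congr rfl fun i _ => ?_
        rw [ContinuousLinearMap.adjoint_inner_right, norm_inner_symm,
          ← ContinuousLinearMap.adjoint_inner_right s, hs']
    _ ≤ ‖ContinuousLinearMap.adjoint x (s (e j))‖ ^ 2 := e.orthonormal.sum_inner_products_le _
    _ ≤ ‖x‖ ^ 2 * ‖s (e j)‖ ^ 2 := by
        rw [← mul_pow]
        gcongr
        simpa using (ContinuousLinearMap.adjoint x).le_opNorm (s (e j))

/-- `|Tr(a x)| ≤ ‖a‖₁ ‖x‖`. -/
theorem norm_trace_mul_le {e : HilbertBasis ι ℂ H} {a : H →L[ℂ] H} (ha : IsTraceClass e a)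
    (x : H →L[ℂ] H) : ‖trace e (a * x)‖ ≤ traceNorm e a * ‖x‖ := by
  obtain ⟨u, hu, hua⟩ := exists_contraction_mul_eq (a := a) (b := CFC.abs a)
    fun v => (norm_abs_apply a v).ge
  -- With `a = u s s`, each diagonal entry of `a x` is `⟪s u* (e i), s x (e i)⟫`, a product of two
  -- Hilbert-Schmidt terms.
  set s := CFC.sqrt (CFC.abs a)
  have hss : s * s = CFC.abs a := CFC.sqrt_mul_sqrt_self _ (CFC.abs_nonneg a)
  have hsa : IsSelfAdjoint s := (CFC.sqrt_nonneg (CFC.abs a)).isSelfAdjoint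
  have hs' : ContinuousLinearMap.adjoint s = s := hsa
  have hsq : ∀ v, ‖s v‖ ^ 2 = (⟪v, CFC.abs a v⟫_ℂ).re := by
    intro v
    rw [← hss, _root_.mul_apply_eq_comp, ← ContinuousLinearMap.adjoint_inner_left, hs',
      inner_self_eq_norm_sq_to_K]
    norm_cast
  have hsum : Summable fun i => ‖s (e i)‖ ^ 2 := by simpa only [hsq, IsTraceClass] using ha
  have htn : traceNorm e a = ∑' i, ‖s (e i)‖ ^ 2 := by simp only [hsq]; rfl
  have ht0 : 0 ≤ traceNorm e a := by rw [htn]; positivity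
  have hpart : ∀ F : Finset ι, ∑ i ∈ F, ‖⟪e i, (a * x) (e i)⟫_ℂ‖ ≤ traceNorm e a * ‖x‖ := by
    intro F
    have h1 := sum_norm_sq_mul_le e hsa hsum x F
    have h2 := sum_norm_sq_mul_le e hsa hsum (ContinuousLinearMap.adjoint u) F
    rw [← htn] at h1 h2
    have hu2 : ‖ContinuousLinearMap.adjoint u‖ ^ 2 ≤ 1 := by
      simpa using pow_le_one₀ (n := 2) (norm_nonneg u) hu
    calc ∑ i ∈ F, ‖⟪e i, (a * x) (e i)⟫_ℂ‖
        ≤ ∑ i ∈ F, ‖s (ContinuousLinearMap.adjoint u (e i))‖ * ‖s (x (e i))‖ := by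
          refine Finset.sum_le_sum fun i _ => ?_
          have : (a * x) (e i) = u (s (s (x (e i)))) := by
            rw [← hua, ← hss]; rfl
          rw [this, ← ContinuousLinearMap.adjoint_inner_left,
            ← ContinuousLinearMap.adjoint_inner_left, hs']
          exact norm_inner_le_norm _ _
      _ ≤ √(∑ i ∈ F, ‖s (ContinuousLinearMap.adjoint u (e i))‖ ^ 2) *
          √(∑ i ∈ F, ‖s (x (e i))‖ ^ 2) := Real.sum_mul_le_sqrt_mul_sqrt _ _ _
      _ ≤ √(traceNorm e a) * √(‖x‖ ^ 2 * traceNorm e a) := by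
          gcongr
          exact h2.trans (mul_le_of_le_one_left ht0 hu2)
      _ = traceNorm e a * ‖x‖ := by
          rw [Real.sqrt_mul (sq_nonneg _), Real.sqrt_sq (norm_nonneg _), mul_left_comm,
            Real.mul_self_sqrt ht0, mul_comm]
  have hsn : Summable fun i => ‖⟪e i, (a * x) (e i)⟫_ℂ‖ :=
    summable_of_sum_le (fun _ => norm_nonneg _) hpart
  exact (norm_tsum_le_tsum_norm hsn).trans
    (Real.tsum_le_of_sum_le (fun _ => norm_nonneg _) hpart)

/-! ### Finite rank operators -/

variable (H) in
/-- The finite rank operators, as the span of the rank one operators. -/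
def finiteRank : Submodule ℂ (H →L[ℂ] H) :=
  Submodule.span ℂ {a | ∃ p q : H, a = rankOne ℂ p q}

theorem rankOne_mem_finiteRank (p q : H) : rankOne ℂ p q ∈ finiteRank H :=
  Submodule.subset_span ⟨p, q, rfl⟩

theorem rankOne_mul (p q : H) (y : H →L[ℂ] H) :
    rankOne ℂ p q * y = rankOne ℂ p (ContinuousLinearMap.adjoint y q) :=
  InnerProductSpace.rankOne_comp p q y

theorem mul_mem_finiteRank {a : H →L[ℂ] H} (ha : a ∈ finiteRank H) (y : H →L[ℂ] H) :
    a * y ∈ finiteRank H := by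
  induction ha using Submodule.span_induction with
  | mem a h =>
    obtain ⟨p, q, rfl⟩ := h
    rw [rankOne_mul]
    exact rankOne_mem_finiteRank _ _
  | zero => simp
  | add a b _ _ iha ihb => rw [add_mul]; exact add_mem iha ihb
  | smul c a _ ih => rw [smul_mul_assoc]; exact Submodule.smul_mem _ _ ih

theorem hasSum_trace_rankOne (e : HilbertBasis ι ℂ H) (p q : H) :
    HasSum (fun i => ⟪e i, rankOne ℂ p q (e i)⟫_ℂ) ⟪q, p⟫_ℂ := by
  simpa only [InnerProductSpace.rankOne_apply, inner_smul_right] using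
    e.hasSum_inner_mul_inner q p

theorem trace_rankOne (e : HilbertBasis ι ℂ H) (p q : H) :
    trace e (rankOne ℂ p q) = ⟪q, p⟫_ℂ :=
  (hasSum_trace_rankOne e p q).tsum_eq

theorem trace_rankOne_mul (e : HilbertBasis ι ℂ H) (p q : H) (y : H →L[ℂ] H) :
    trace e (rankOne ℂ p q * y) = ⟪q, y p⟫_ℂ := by
  rw [rankOne_mul, trace_rankOne, ContinuousLinearMap.adjoint_inner_left]

theorem exists_traceBound (e : HilbertBasis ι ℂ H) {a : H →L[ℂ] H} (ha : a ∈ finiteRank H) :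
    ∃ C, TraceBound e a C := by
  induction ha using Submodule.span_induction with
  | mem a h =>
    obtain ⟨p, q, rfl⟩ := h
    exact ⟨_, TraceBound.rankOne p q⟩
  | zero => exact ⟨0, TraceBound.zero⟩
  | add a b _ _ iha ihb =>
    obtain ⟨C, hC⟩ := iha
    obtain ⟨D, hD⟩ := ihb
    exact ⟨_, hC.add hD⟩
  | smul c a _ ih =>
    obtain ⟨C, hC⟩ := ih
    exact ⟨_, hC.smul c⟩

theorem summable_trace (e : HilbertBasis ι ℂ H) {a : H →L[ℂ] H} (ha : a ∈ finiteRank H) :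
    Summable fun i => ⟪e i, a (e i)⟫_ℂ := by
  induction ha using Submodule.span_induction with
  | mem a h =>
    obtain ⟨p, q, rfl⟩ := h
    exact (hasSum_trace_rankOne e p q).summable
  | zero => simp
  | add a b _ _ iha ihb => simpa [inner_add_right] using iha.add ihb
  | smul c a _ ih => simpa [inner_smul_right] using ih.mul_left c

/-- The trace of `a y`, as a linear functional of the finite rank operator `a`. -/
def traceMul (e : HilbertBasis ι ℂ H) (y : H →L[ℂ] H) : finiteRank H →ₗ[ℂ] ℂ where
  toFun a := trace e (a * y)
  map_add' a b := by
    have ha := summable_trace e (mul_mem_finiteRank a.2 y)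
    have hb := summable_trace e (mul_mem_finiteRank b.2 y)
    simp only [trace, ← ha.tsum_add hb, ← inner_add_right]
    rfl
  map_smul' c a := by
    simp only [trace, RingHom.id_apply, smul_eq_mul, ← tsum_mul_left, ← inner_smul_right]
    rfl

theorem traceMul_apply (e : HilbertBasis ι ℂ H) (y : H →L[ℂ] H) (a : finiteRank H) :
    traceMul e y a = trace e (a * y) := rfl

/-- Trace functionals of linearly independent operators can be prescribed independently. -/
theorem pi_traceMul_surjective (e : HilbertBasis ι ℂ H) {κ : Type*} [Fintype κ]
    {y : κ → H →L[ℂ] H} (hy : LinearIndependent ℂ y) :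
    Function.Surjective (LinearMap.pi fun k => traceMul e (y k)) := by
  classical
  rw [← LinearMap.range_eq_top]
  by_contra hne
  -- A nonzero functional killing the range would, tested on rank one operators, give a linear
  -- relation among the `y k`.
  obtain ⟨f, hf0, hf⟩ := Submodule.exists_le_ker_of_lt_top _ (lt_top_iff_ne_top.mpr hne)
  apply hf0
  have hfe : ∀ g : κ → ℂ, f g = ∑ k, g k * f (Pi.single k 1) := fun g => by
    rw [LinearMap.pi_apply_eq_sum_univ f g]
    refine Finset.sum_congr rfl fun k _ => ?_
    rw [smul_eq_mul]
    congr 2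
    ext j
    simp [Pi.single_apply, eq_comm]
  have hcomb : ∑ k, f (Pi.single k 1) • y k = 0 := by
    ext p
    apply ext_inner_left ℂ
    intro q
    have h : f (LinearMap.pi (fun k => traceMul e (y k)) ⟨_, rankOne_mem_finiteRank p q⟩) = 0 :=
      hf ⟨_, rfl⟩
    rw [hfe] at h
    simp only [LinearMap.pi_apply, traceMul_apply, trace_rankOne_mul] at h
    rw [_root_.zero_apply, inner_zero_right, ← h, _root_.sum_apply,
      inner_sum]
    exact Finset.sum_congr rfl fun k _ => by
      rw [_root_.smul_apply, inner_smul_right, mul_comm]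
  have hz := Fintype.linearIndependent_iff.mp hy _ hcomb
  ext k
  simpa using hz k

theorem trace_smul (e : HilbertBasis ι ℂ H) (c : ℂ) (a : H →L[ℂ] H) :
    trace e (c • a) = c * trace e a := by
  simp only [trace, ← tsum_mul_left, ← inner_smul_right]
  rfl

theorem traceNorm_smul (e : HilbertBasis ι ℂ H) (c : ℂ) (a : H →L[ℂ] H) :
    traceNorm e (c • a) = ‖c‖ * traceNorm e a := by
  simp only [traceNorm, ← tsum_mul_left, CFC.abs_smul]
  refine tsum_congr fun i => ?_
  rw [_root_.smul_apply, RCLike.real_smul_eq_coe_smul (K := ℂ), inner_smul_right]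
  exact Complex.re_ofReal_mul _ _

theorem trace_mul_sum (e : HilbertBasis ι ℂ H) {a : H →L[ℂ] H} (ha : a ∈ finiteRank H)
    {κ : Type*} (s : Finset κ) (g : κ → ℂ) (y : κ → H →L[ℂ] H) :
    trace e (a * ∑ k ∈ s, g k • y k) = ∑ k ∈ s, g k * trace e (a * y k) := by
  simp only [← trace_smul]
  simp only [trace]
  rw [← Summable.tsum_finsetSum fun k _ =>
    summable_trace e (Submodule.smul_mem _ (g k) (mul_mem_finiteRank ha (y k)))]
  refine tsum_congr fun i => ?_
  simp [Finset.mul_sum]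

/-! ### The dual formula for the distance -/

/-- The trace pairings of `x` with the unit trace norm operators annihilating `V`. -/
def dualPairings (e : HilbertBasis ι ℂ H) (V : Submodule ℂ (H →L[ℂ] H)) (x : H →L[ℂ] H) : Set ℝ :=
  {r : ℝ | ∃ a : H →L[ℂ] H, IsTraceClass e a ∧ a ∈ traceAnnihilator e V ∧ traceNorm e a = 1 ∧
    r = ‖trace e (a * x)‖}

theorem norm_mem_upperBounds_dualPairings (e : HilbertBasis ι ℂ H)
    (V : Submodule ℂ (H →L[ℂ] H)) (x : H →L[ℂ] H) : ‖x‖ ∈ upperBounds (dualPairings e V x) := by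
  rintro _ ⟨a, ha, _, ha1, rfl⟩
  simpa [ha1] using norm_trace_mul_le ha x

/-- Rescale `a` to trace norm 1; a nonzero pairing with `x` makes this possible and also yields `0 ≤
M`. -/
theorem norm_trace_le_of_mem_upperBounds {e : HilbertBasis ι ℂ H}
    {V : Submodule ℂ (H →L[ℂ] H)} {x a : H →L[ℂ] H} {M C : ℝ}
    (hM : M ∈ upperBounds (dualPairings e V x)) (ha : a ∈ finiteRank H)
    (haV : ∀ y ∈ V, trace e (a * y) = 0) (hC : TraceBound e a C) (hne : trace e (a * x) ≠ 0) :
    ‖trace e (a * x)‖ ≤ M * C := by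
  have hpos : 0 < traceNorm e a := by
    by_contra! h
    have h1 := norm_trace_mul_le hC.isTraceClass x
    have h2 := mul_nonpos_of_nonpos_of_nonneg h (norm_nonneg x)
    exact hne (norm_le_zero_iff.mp (h1.trans h2))
  set c : ℂ := (((traceNorm e a)⁻¹ : ℝ) : ℂ)
  have hc : ‖c‖ = (traceNorm e a)⁻¹ := by
    simp [c, abs_of_pos hpos]
  have hmem : ‖trace e ((c • a) * x)‖ ∈ dualPairings e V x := by
    refine ⟨c • a, (hC.smul c).isTraceClass, fun y hy => ⟨?_, ?_⟩, ?_, rfl⟩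
    · obtain ⟨D, hD⟩ := exists_traceBound e
        (mul_mem_finiteRank (Submodule.smul_mem _ c ha) y)
      exact hD.isTraceClass
    · rw [smul_mul_assoc, trace_smul, haV y hy, mul_zero]
    · rw [traceNorm_smul, hc, inv_mul_cancel₀ hpos.ne']
  have h1 := hM hmem
  rw [smul_mul_assoc, trace_smul, norm_mul, hc, inv_mul_le_iff₀ hpos] at h1
  have hM0 : 0 ≤ M := (norm_nonneg _).trans (hM hmem)
  calc _ ≤ traceNorm e a * M := h1
    _ ≤ C * M := by gcongr; exact hC.traceNorm_le
    _ = M * C := mul_comm _ _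

/-- A weakly null maximizing sequence for `x` yields rank one operators which, after small finite
rank corrections, annihilate `V` and norm `x` asymptotically. -/
theorem norm_le_of_mem_upperBounds {e : HilbertBasis ι ℂ H} {V : Submodule ℂ (H →L[ℂ] H)}
    [FiniteDimensional ℂ V] (hVK : V ≤ compacts H) {x : H →L[ℂ] H} (hx : x ≠ 0) {v : ℕ → H}
    (hv : ∀ n, ‖v n‖ = 1) (hxv : Tendsto (fun n => ‖x (v n)‖) atTop (𝓝 ‖x‖))
    (hw : ∀ ζ, Tendsto (fun n => ⟪v n, ζ⟫_ℂ) atTop (𝓝 0)) {M : ℝ}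
    (hM : M ∈ upperBounds (dualPairings e V x)) : ‖x‖ ≤ M := by
  classical
  let b := Module.finBasis ℂ V
  set y : Fin (Module.finrank ℂ V) → H →L[ℂ] H := fun k => b k with hy
  have hyind : LinearIndependent ℂ y :=
    b.linearIndependent.map' V.subtype V.ker_subtype
  choose c hc using fun k => pi_traceMul_surjective e hyind (Pi.single k 1)
  have hcy : ∀ k j, trace e ((c k : H →L[ℂ] H) * y j) = if j = k then 1 else 0 := fun k j => by
    rw [← traceMul_apply]
    simpa [Pi.single_apply] using congrFun (hc k) j
  choose B hB using fun k => exists_traceBound e (c k).2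
  let η : ℕ → H := fun n => ((‖x (v n)‖⁻¹ : ℝ) : ℂ) • x (v n)
  have hη : ∀ n, ‖η n‖ ≤ 1 := fun n => by
    simp only [η, norm_smul, Complex.norm_real, norm_inv, norm_norm]
    exact inv_mul_le_one
  -- Chosen to cancel the pairing of the rank one operator with `y k`; it tends to 0 because `y k`
  -- is compact.
  let t : ℕ → Fin (Module.finrank ℂ V) → ℂ := fun n k => -⟪η n, y k (v n)⟫_ℂ
  have ht : ∀ k, Tendsto (fun n => t n k) atTop (𝓝 0) := fun k => by
    refine squeeze_zero_norm (fun n => ?_)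
      (by simpa using (tendsto_compact_apply_zero (hVK (b k).2) hv hw).norm)
    rw [norm_neg]
    exact (norm_inner_le_norm _ _).trans (mul_le_of_le_one_left (norm_nonneg _) (hη n))
  let A : ℕ → finiteRank H := fun n =>
    ⟨rankOne ℂ (v n) (η n), rankOne_mem_finiteRank _ _⟩ + ∑ k, t n k • c k
  have hAtr : ∀ n z, trace e ((A n : H →L[ℂ] H) * z) =
      ⟪η n, z (v n)⟫_ℂ + ∑ k, t n k * trace e ((c k : H →L[ℂ] H) * z) := fun n z => by
    rw [← traceMul_apply]
    simp only [A, map_add, map_sum, map_smul, smul_eq_mul]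
    simp only [traceMul_apply, trace_rankOne_mul]
  have hAV : ∀ n, ∀ z ∈ V, trace e ((A n : H →L[ℂ] H) * z) = 0 := by
    intro n z hz
    have hz' : z = ∑ k, b.repr ⟨z, hz⟩ k • y k := by
      have := congrArg V.subtype (b.sum_repr ⟨z, hz⟩)
      rw [map_sum] at this
      exact this.symm
    rw [hz', trace_mul_sum e (A n).2]
    refine Finset.sum_eq_zero fun j _ => ?_
    rw [hAtr]
    simp [hcy, t]
  have hAB : ∀ n, TraceBound e (A n : H →L[ℂ] H) (‖v n‖ * ‖η n‖ + ∑ k, ‖t n k‖ * B k) := by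
    intro n
    have := (TraceBound.rankOne (e := e) (v n) (η n)).add
      (TraceBound.sum Finset.univ fun k _ => (hB k).smul (t n k))
    simpa [A] using this
  have hlim : Tendsto (fun n => ‖trace e ((A n : H →L[ℂ] H) * x)‖) atTop (𝓝 ‖x‖) := by
    have h1 : ∀ n, ⟪η n, x (v n)⟫_ℂ = ((‖x (v n)‖ : ℝ) : ℂ) := fun n => by
      rw [inner_smul_left, inner_self_eq_norm_sq_to_K, Complex.conj_ofReal]
      by_cases h : ‖x (v n)‖ = 0
      · simp [h]
      · have h' : ((‖x (v n)‖ : ℝ) : ℂ) ≠ 0 := by exact_mod_cast h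
        push_cast
        change _⁻¹ * ((‖x (v n)‖ : ℝ) : ℂ) ^ 2 = _
        field_simp
    have h2 : Tendsto (fun n => trace e ((A n : H →L[ℂ] H) * x)) atTop
        (𝓝 (((‖x‖ : ℝ) : ℂ) + ∑ k, 0 * trace e ((c k : H →L[ℂ] H) * x))) := by
      simp only [hAtr, h1]
      exact ((Complex.continuous_ofReal.tendsto _).comp hxv).add
        (tendsto_finsetSum _ fun k _ => (ht k).mul_const _)
    simpa using h2.norm
  have hlimB : Tendsto (fun n => M * (1 + ∑ k, ‖t n k‖ * B k)) atTop (𝓝 M) := by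
    have h3 : Tendsto (fun n => ∑ k, ‖t n k‖ * B k) atTop
        (𝓝 (∑ k, ‖(0 : ℂ)‖ * B k)) :=
      tendsto_finsetSum _ fun k _ => (ht k).norm.mul_const _
    simpa using (h3.const_add 1).const_mul M
  -- An upper bound of a possibly empty set has no sign a priori; `x ≠ 0` supplies an `A n` with
  -- nonzero pairing.
  have hM0 : 0 ≤ M := by
    obtain ⟨n, hn⟩ := (hlim.eventually_ne (norm_ne_zero_iff.mpr hx)).exists
    have hn' := norm_ne_zero_iff.mp hn
    have hle := norm_trace_le_of_mem_upperBounds hM (A n).2 (hAV n) (hAB n) hn'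
    have hC0 : 0 ≤ ‖v n‖ * ‖η n‖ + ∑ k, ‖t n k‖ * B k := by
      simpa using hAB n 0 (by simp) ∅
    by_contra! hneg
    have := mul_nonpos_of_nonpos_of_nonneg hneg.le hC0
    exact hn (le_antisymm (hle.trans this) (norm_nonneg _))
  refine le_of_tendsto_of_tendsto hlim hlimB ?_
  filter_upwards [hlim.eventually_ne (norm_ne_zero_iff.mpr hx)] with n hn
  refine (norm_trace_le_of_mem_upperBounds hM (A n).2 (hAV n) (hAB n)
    (norm_ne_zero_iff.mp hn)).trans ?_
  gcongr
  rw [hv, one_mul]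
  exact hη n

end OperatorDistance

end

theorem mainTheorem6 {H : Type*} [NormedAddCommGroup H] [InnerProductSpace ℂ H]
    [CompleteSpace H] (hH : ¬ FiniteDimensional ℂ H)
    {ι : Type*} (e : HilbertBasis ι ℂ H)
    (V : Submodule ℂ (H →L[ℂ] H)) (hVfin : FiniteDimensional ℂ V)
    (hVK : V ≤ OperatorDistance.compacts H)
    (x : H →L[ℂ] H) (hx : x ∉ OperatorDistance.compacts H)
    (hattain : OperatorDistance.AttainsNormEverywhere x ∨
      OperatorDistance.AttainsNormNowhere x) :
    Metric.infDist x (OperatorDistance.compacts H : Set (H →L[ℂ] H)) =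
        Metric.infDist x (V : Set (H →L[ℂ] H)) ∧
      IsLUB {r : ℝ | ∃ a : H →L[ℂ] H, OperatorDistance.IsTraceClass e a ∧
          a ∈ OperatorDistance.traceAnnihilator e V ∧
          OperatorDistance.traceNorm e a = 1 ∧
          r = ‖OperatorDistance.trace e (a * x)‖}
        (Metric.infDist x (V : Set (H →L[ℂ] H))) ∧
      Metric.infDist x (V : Set (H →L[ℂ] H)) = ‖x‖ := by
  obtain ⟨v, hv, hxv, hw⟩ := OperatorDistance.exists_weaklyNull_maximizing_seq hH e hattain
  -- Noncompactness of `x` enters only here.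
  have hx0 : x ≠ 0 := fun h => hx (h ▸ zero_mem _)
  have hdist : ∀ W : Submodule ℂ (H →L[ℂ] H), W ≤ OperatorDistance.compacts H →
      Metric.infDist x (W : Set (H →L[ℂ] H)) = ‖x‖ := by
    intro W hW
    refine le_antisymm ?_ ?_
    · simpa using Metric.infDist_le_dist_of_mem (x := x) (zero_mem W)
    · refine (Metric.le_infDist ⟨0, zero_mem W⟩).mpr fun k hk => ?_
      rw [dist_eq_norm]
      exact OperatorDistance.norm_le_norm_sub_compact (hW hk) hv hxv hw
  rw [hdist _ le_rfl, hdist V hVK]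
  exact ⟨rfl, ⟨OperatorDistance.norm_mem_upperBounds_dualPairings e V x,
    fun _ hM => OperatorDistance.norm_le_of_mem_upperBounds hVK hx0 hv hxv hw hM⟩, rfl⟩
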